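/- **Setting.** There are $T$ rounds. In round $t$ the learner plays $x_t\in[0,1]$, depending only on past rewards, and observes $y_t=f(x_t)+\epsilon_t$, where $f(x)=\mu_1\mathbb 1\{x\le x^*\}+\mu_2\mathbb 1\{x>x^*\}$ with $\mu_1\ne\mu_2$ real and $x^*\in[0,1)$, and the noise variables $\epsilon_t$ are i.i.d., mean-zero and $\sigma^2$-sub-Gaussian ($\mathbb E e^{s\epsilon_t}\le e^{\sigma^2s^2/2}$ for all real $s$) with $\sigma>0$. Write $\Delta=|\mu_1-\mu_2|$, and let $V(\Delta,\sigma)$ be the set of all such environments with these $\Delta,\sigma$. Let $\eta\in(0,1/2)$ be the tolerance, $\ell_\eta=\log_2\frac1{2\eta}$ and $$T_1=\frac{\sigma^2}{\Delta^2}\Big(1.59\log\Big\lfloor\frac1{2\eta}\Big\rfloor-2\log 2\Big).$$ **SH and SHB.** Both keep a triple $(a_1,a_2,a_3)$, initially $(0,\tfrac12,1)$. Zooming in to the right replaces it by $(a_2,\frac{a_2+a_3}2,a_3)$ and zooming in to the left by $(a_1,\frac{a_1+a_2}2,a_2)$. * $\mathrm{SH}(b,\eta)$ has $J=\lceil\ell_\eta\rceil$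 phases. In each of them it plays each of $a_1,a_2,a_3$ exactly $\lfloor b/(3J)\rfloor$ times, obtaining empirical means $m_1,m_2,m_3$ of the rewards of this phase, and zooms in to the right if $|m_1-m_2|<|m_2-m_3|$, to the left otherwise. * $\mathrm{SHB}(b,\eta)$ has $J_B=\lceil 6\log\frac1{2\eta}\rceil$ phases. In each of them it plays each of the five actions $a_1,a_2,a_3,0,1$ exactly $\lfloor b/(5J_B)\rfloor$ times, obtaining $m_1,m_2,m_3,m_0',m_1'$. If $$\Big|\tfrac{m_0'+m_1}2-\tfrac{m_3+m_1'}2\Big|<\tfrac34\max\Big(\Big|\tfrac{m_0'+m_1+m_3}3-m_1'\Big|,\Big|m_0'-\tfrac{m_1+m_3+m_1'}3\Big|\Big),$$ it returns to the triple from which it zoomed in to reach the current one (the initial triple is left unchanged); otherwise it zooms in by the rule of SH. Both return the value of $a_2$ after the last phase. **Adaptive Sequential Halving (SHA)** with hyperparameters $\gamma$ and $L$ knows $\sigma$, $\eta$, $T$. It plays $0$ and $1$ each $\lfloor L/2\rfloor$ times, lets $\hat\Delta$ be the absolute difference of the two empirical means and $\tau=\gamma\frac{\sigma^2}{\hat\Delta^2}\log\frac1{2\eta}$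 ($\tau=\infty$ if $\hat\Delta=0$), and then runs, on new rounds, $\mathrm{SHB}(T-L,\eta)$ if $T\ge\tau$ and $\mathrm{SH}(T-L,\eta)$ if $T<\tau$. Its estimate $\hat x_T$ is the value returned. **Theorem.** There are universal constants $c_1,c_2,c_3>0$ such that the following holds. Let $T\in\mathbb N$, $\eta\in(0,1/2)$, $\sigma>0$, $B\in(2/T,1-2/T)$, $L=BT$, $\gamma\in\big((\sqrt{104/B}+\sqrt{1.59})^2,\ 1800/(1-B)\big)$, and assume that $T-L\ge 5\lceil 6\log\frac1{2\eta}\rceil$, so that SHB, and then also SH, plays every action at least once in every phase. Then, in every environment of $V(\Delta,\sigma)$, the estimate $\hat x_T$ of SHA satisfies $$\mathbb P(|\hat x_T-x^*|\ge\eta)\le\begin{cases}4\lceil\ell_\eta\rceil\exp\Big(\dfrac{-c_1(1-B)\Delta^2T}{\sigma^2\ell_\eta}\Big),&T<T_1,\\[2mm]5\exp\Big(-\dfrac{c_2B(1-B)\Delta^2}{\sigma^2}T+c_3\ell_\eta\Big),&T\ge T_1.\end{cases}$$ -/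

import Mathlib

open MeasureTheory ProbabilityTheory

noncomputable section

namespace ChangePoint

/-- A piecewise constant bandit environment on the action space `[0, 1]`: two distinct mean
rewards, one change point in `[0, 1)`, and the common law of the noise variables. -/
structure Environment where
  mean₁ : ℝ
  mean₂ : ℝ
  mean_ne : mean₁ ≠ mean₂
  changePt : ℝ
  changePt_mem : changePt ∈ Set.Ico (0 : ℝ) 1
  noise : Measure ℝ
  isProbabilityMeasure_noise : IsProbabilityMeasure noise

attribute [instance] Environment.isProbabilityMeasure_noise

/-- The class `V(Δ, σ)`: change in mean `Δ` and mean-zero `σ²`-sub-Gaussian noise,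
that is, `E[exp(s ε)] ≤ exp(σ² s² / 2)` for every real `s`. -/
def Environment.InClass (v : Environment) (Δ σ : ℝ) : Prop :=
  |v.mean₁ - v.mean₂| = Δ ∧
    ∫ e, e ∂v.noise = 0 ∧
    HasSubgaussianMGF (fun e : ℝ => e) (Real.toNNReal (σ ^ 2)) v.noise

/-- The mean reward function `f(x) = μ₁ 1{x ≤ x*} + μ₂ 1{x > x*}`. -/
def Environment.meanReward (v : Environment) (x : ℝ) : ℝ :=
  if x ≤ v.changePt then v.mean₁ else v.mean₂

/-- The law of the i.i.d. noise sequence `ε₀, ε₁, …`, one variable for each round. -/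
def Environment.noiseLaw (v : Environment) : Measure (ℕ → ℝ) :=
  Measure.infinitePi fun _ => v.noise

/-- The reward `y_t = f(x) + ε_t` observed when action `x` is played in round `t`
(rounds are numbered from `0`). -/
def Environment.reward (v : Environment) (ε : ℕ → ℝ) (t : ℕ) (x : ℝ) : ℝ :=
  v.meanReward x + ε t

/-! An algorithm is run against `y : ℕ → ℝ → ℝ`, where `y t x` is the reward observed if `x` is
played in round `t`. Every round is used for at most one action, and the action of a round only
depends on the rewards of earlier rounds. -/

/-- The empirical mean of the rewards when `x` is played in the `n` consecutive rounds
`s, …, s + n - 1`. -/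
def empMean (y : ℕ → ℝ → ℝ) (s n : ℕ) (x : ℝ) : ℝ :=
  (∑ i ∈ Finset.range n, y (s + i) x) / n

/-- Left end, midpoint and right end of the current region. -/
structure Points where
  a₁ : ℝ
  a₂ : ℝ
  a₃ : ℝ

/-- The sampling points of the first phase. -/
def Points.init : Points := ⟨0, 1 / 2, 1⟩

/-- Zooming in to the right. -/
def Points.zoomR (A : Points) : Points := ⟨A.a₂, (A.a₂ + A.a₃) / 2, A.a₃⟩

/-- Zooming in to the left. -/
def Points.zoomL (A : Points) : Points := ⟨A.a₁, (A.a₁ + A.a₂) / 2, A.a₂⟩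

/-- The event `E_R`, in terms of the empirical means at `a₁, a₂, a₃`. -/
def EventR (m₁ m₂ m₃ : ℝ) : Prop := |m₁ - m₂| < |m₂ - m₃|

/-- The event `E_P`, in terms of the empirical means at `0, a₁, a₃, 1`. -/
def EventP (mzero m₁ m₃ mone : ℝ) : Prop :=
  |(mzero + m₁) / 2 - (m₃ + mone) / 2| <
    3 / 4 * max |(mzero + m₁ + m₃) / 3 - mone| |mzero - (m₁ + m₃ + mone) / 3|

/-! ### Sequential halving without backtracking -/

open Classical in
/-- One phase of SH: from round `s` on, play each of `a₁, a₂, a₃` for `n` rounds, then zoom in. -/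
def shStep (y : ℕ → ℝ → ℝ) (s n : ℕ) (A : Points) : Points :=
  if EventR (empMean y s n A.a₁) (empMean y (s + n) n A.a₂) (empMean y (s + 2 * n) n A.a₃)
  then A.zoomR else A.zoomL

/-- The sampling points of SH after `j` phases of `3 n` rounds each, starting in round `s`. -/
def shPoints (y : ℕ → ℝ → ℝ) (s n : ℕ) : ℕ → Points
  | 0 => Points.init
  | j + 1 => shStep y (s + 3 * n * j) n (shPoints y s n j)

/-- The number of phases of SH. -/
def shPhases (η : ℝ) : ℕ := ⌈Real.logb 2 (1 / (2 * η))⌉₊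

/-- The estimate of SH with tolerance `η` and budget `b`, started in round `s`. -/
def SH (y : ℕ → ℝ → ℝ) (s : ℕ) (b η : ℝ) : ℝ :=
  (shPoints y s ⌊b / (3 * shPhases η)⌋₊ (shPhases η)).a₂

/-! ### Sequential halving with backtracking -/

/-- The sampling points reached from the initial ones by a list of zooms, the most recent zoom
first (`true` is a zoom to the right, `false` one to the left). -/
def pointsOf : List Bool → Points
  | [] => Points.init
  | true :: h => (pointsOf h).zoomR
  | false :: h => (pointsOf h).zoomL

open Classical in
/-- One phase of SHB: from round `s` on, play each of `a₁, a₂, a₃, 0, 1` for `n` rounds, then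
undo the most recent zoom that is still in force, or zoom in. The state is the list of zooms in
force. In the initial state there is nothing to undo, and undoing leaves it unchanged. -/
def shbStep (y : ℕ → ℝ → ℝ) (s n : ℕ) (h : List Bool) : List Bool :=
  let A := pointsOf h
  let m₁ := empMean y s n A.a₁
  let m₂ := empMean y (s + n) n A.a₂
  let m₃ := empMean y (s + 2 * n) n A.a₃
  let mzero := empMean y (s + 3 * n) n 0
  let mone := empMean y (s + 4 * n) n 1
  if EventP mzero m₁ m₃ mone then h.tail
  else if EventR m₁ m₂ m₃ then true :: h
  else false :: h

/-- The state of SHB after `j` phases of `5 n` rounds each, starting in round `s`. -/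
def shbState (y : ℕ → ℝ → ℝ) (s n : ℕ) : ℕ → List Bool
  | 0 => []
  | j + 1 => shbStep y (s + 5 * n * j) n (shbState y s n j)

/-- The number of phases of SHB. -/
def shbPhases (η : ℝ) : ℕ := ⌈6 * Real.log (1 / (2 * η))⌉₊

/-- The estimate of SHB with tolerance `η` and budget `b`, started in round `s`. -/
def SHB (y : ℕ → ℝ → ℝ) (s : ℕ) (b η : ℝ) : ℝ :=
  (pointsOf (shbState y s ⌊b / (5 * shbPhases η)⌋₊ (shbPhases η))).a₂

/-! ### Adaptive sequential halving -/

/-- The estimate of `Δ` from playing `0` and then `1`, each for `n` rounds. -/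
def deltaHat (y : ℕ → ℝ → ℝ) (n : ℕ) : ℝ := |empMean y n n 1 - empMean y 0 n 0|

/-- The estimated budget threshold `τ`, for an estimate `D ≠ 0` of `Δ`. -/
def threshold (γ σ η D : ℝ) : ℝ := γ * (σ ^ 2 / D ^ 2) * Real.log (1 / (2 * η))

open Classical in
/-- The estimate of SHA with hyperparameters `γ` and `L`, tolerance `η`, noise parameter `σ` and
budget `T`. The endpoints are played `⌊L / 2⌋` times each. If the estimate of `Δ` is `0`, the
threshold is infinite, and SH is run. -/
def SHA (y : ℕ → ℝ → ℝ) (γ L η σ T : ℝ) : ℝ :=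
  let n := ⌊L / 2⌋₊
  let D := deltaHat y n
  if D ≠ 0 ∧ threshold γ σ η D ≤ T then SHB y (2 * n) (T - L) η
  else SH y (2 * n) (T - L) η

/-- The probability that SHA misses the change point of `v` by at least `η`. -/
def Environment.failProbSHA (v : Environment) (γ L η σ T : ℝ) : ℝ :=
  v.noiseLaw.real {ε | η ≤ |SHA (v.reward ε) γ L η σ T - v.changePt|}

/-- The budget `T₁` that separates the small from the large budgets. -/
def budgetT₁ (Δ σ η : ℝ) : ℝ :=
  σ ^ 2 / Δ ^ 2 * (1.59 * Real.log (⌊1 / (2 * η)⌋₊ : ℝ) - 2 * Real.log 2)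

end ChangePoint

end

/-! Below `T₁`, and whenever `(1 - B)Δ²T/σ²` is at most a fixed multiple of `log (1/(2η))`, the
claimed bound exceeds one, so only large budgets need work. There the upper limit on `γ` makes SHA
run SHB as soon as the estimate of `Δ` is at least `Δ/2` (`SHA_eq_SHB`), and Hoeffding's inequality
controls the opposite event.

SHB is a walk on the binary tree of regions. Its `progress`, correct zooms minus wrong ones, drops
by at most one in any phase and rises by one if the noise averages of the phase are small against
`Δ` (`progress_shbStep`). Charging each bad phase to its noise gives a pathwise lower bound
(`le_progress_shbState`). The returned point is within `2^-(progress + 1)` of the change point, so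
failure after `N` phases forces the `5N` absolute block averages of the noise to sum to at least
`ΔN/64`. These blocks occupy fixed rounds whatever is played, so adaptivity creates no dependence:
Hoeffding's inequality and a union bound over `2^(5N)` sign patterns suffice. -/

namespace ChangePoint

/-! ### Concentration of the noise -/

/-- The average of the noise in the `n` rounds from round `s` on. -/
noncomputable def noiseMean (ε : ℕ → ℝ) (s n : ℕ) : ℝ := (∑ i ∈ Finset.range n, ε (s + i)) / n

lemma empMean_reward (v : Environment) (ε : ℕ → ℝ) (s : ℕ) {n : ℕ} (hn : 0 < n) (x : ℝ) :
    empMean (v.reward ε) s n x = v.meanReward x + noiseMean ε s n := by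
  have : (n : ℝ) ≠ 0 := by positivity
  simp only [empMean, Environment.reward, noiseMean, Finset.sum_add_distrib, Finset.sum_const,
    Finset.card_range, nsmul_eq_mul]
  field_simp

instance (v : Environment) : IsProbabilityMeasure v.noiseLaw := by
  unfold Environment.noiseLaw; infer_instance

/-- Hoeffding's inequality for signed sums of noise variables. -/
lemma noiseLaw_signed_sum_ge_le {v : Environment} {Δ σ : ℝ} (hv : v.InClass Δ σ)
    (a : ℕ → ℝ) (ha : ∀ t, a t = 1 ∨ a t = -1) (s m : ℕ) {x : ℝ} (hx : 0 ≤ x) :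
    v.noiseLaw.real {ε | x ≤ ∑ t ∈ Finset.range m, a t * ε (s + t)} ≤
      Real.exp (-x ^ 2 / (2 * m * σ ^ 2)) := by
  have hind : iIndepFun (fun (t : ℕ) (ε : ℕ → ℝ) => ε t) v.noiseLaw :=
    iIndepFun_infinitePi (X := fun _ e => e) (by fun_prop)
  have hind' : iIndepFun (fun (t : ℕ) (ε : ℕ → ℝ) => a t * ε (s + t)) v.noiseLaw :=
    (hind.precomp (add_right_injective s)).comp (fun t e => a t * e) (by fun_prop)
  have hsub (t : ℕ) : HasSubgaussianMGF (fun ε : ℕ → ℝ => ε t) (Real.toNNReal (σ ^ 2))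
      v.noiseLaw := by
    refine HasSubgaussianMGF.of_map (Y := fun ε : ℕ → ℝ => ε t) (X := fun e : ℝ => e)
      (measurable_pi_apply t).aemeasurable ?_
    rw [Environment.noiseLaw, Measure.infinitePi_map_eval (fun _ : ℕ => v.noise) t]
    exact hv.2.2
  have hsub' (t : ℕ) : HasSubgaussianMGF (fun ε : ℕ → ℝ => a t * ε (s + t))
      (Real.toNNReal (σ ^ 2)) v.noiseLaw := by
    rcases ha t with h | h
    · simpa [h] using hsub (s + t)
    · have := (hsub (s + t)).neg
      refine this.congr (ae_of_all _ fun ε => ?_)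
      simp [h]
  have := HasSubgaussianMGF.measure_sum_range_ge_le_of_iIndepFun hind' (n := m)
    (fun t _ => hsub' t) hx
  rwa [Real.coe_toNNReal _ (sq_nonneg σ)] at this

lemma sum_range_mul_eq (g : ℕ → ℝ) (n Q : ℕ) :
    ∑ t ∈ Finset.range (n * Q), g t =
      ∑ q ∈ Finset.range Q, ∑ i ∈ Finset.range n, g (n * q + i) := by
  induction Q with
  | zero => simp
  | succ Q ih => rw [Nat.mul_succ, Finset.sum_range_add, ih, Finset.sum_range_succ]

/-- A union bound over the signs of the block averages. -/
lemma noiseLaw_sum_abs_noiseMean_ge_le {v : Environment} {Δ σ : ℝ} (hv : v.InClass Δ σ)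
    (s Q : ℕ) {n : ℕ} (hn : 0 < n) {x : ℝ} (hx : 0 ≤ x) :
    v.noiseLaw.real {ε | x ≤ ∑ q ∈ Finset.range Q, |noiseMean ε (s + n * q) n|} ≤
      2 ^ Q * Real.exp (-(n * x ^ 2) / (2 * Q * σ ^ 2)) := by
  classical
  have hn' : (0 : ℝ) < n := by positivity
  -- `W` is the set of blocks counted with sign `+1`. A sum of absolute values is the signed sum for
  -- the pattern matching the signs of the block averages.
  let a : Finset ℕ → ℕ → ℝ := fun W t => if t / n ∈ W then 1 else -1
  have hsub : {ε : ℕ → ℝ | x ≤ ∑ q ∈ Finset.range Q, |noiseMean ε (s + n * q) n|} ⊆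
      ⋃ W ∈ (Finset.range Q).powerset,
        {ε : ℕ → ℝ | n * x ≤ ∑ t ∈ Finset.range (n * Q), a W t * ε (s + t)} := by
    intro ε hε
    simp only [Set.mem_ofPred_eq] at hε
    simp only [Set.mem_iUnion, Set.mem_ofPred_eq]
    refine ⟨{q ∈ Finset.range Q | 0 ≤ noiseMean ε (s + n * q) n}, by simp, ?_⟩
    rw [sum_range_mul_eq]
    calc n * x ≤ n * ∑ q ∈ Finset.range Q, |noiseMean ε (s + n * q) n| := by gcongr
      _ = ∑ q ∈ Finset.range Q, n * |noiseMean ε (s + n * q) n| := Finset.mul_sum ..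
      _ ≤ _ := Finset.sum_le_sum fun q hq => ?_
    have hdiv (i : ℕ) (hi : i ∈ Finset.range n) : (n * q + i) / n = q := by
      rw [Nat.mul_add_div hn, Nat.div_eq_of_lt (Finset.mem_range.1 hi), add_zero]
    have hsum : n * noiseMean ε (s + n * q) n = ∑ i ∈ Finset.range n, ε (s + (n * q + i)) := by
      simp only [noiseMean, add_assoc]
      field_simp
    by_cases h : 0 ≤ noiseMean ε (s + n * q) n
    · rw [abs_of_nonneg h, hsum]
      refine Finset.sum_le_sum fun i hi => ?_
      simp [a, hdiv i hi, h, Finset.mem_range.1 hq]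
    · rw [abs_of_neg (not_le.1 h), mul_neg, hsum, ← Finset.sum_neg_distrib]
      refine Finset.sum_le_sum fun i hi => ?_
      simp [a, hdiv i hi, h]
  calc _ ≤ v.noiseLaw.real (⋃ W ∈ (Finset.range Q).powerset,
        {ε : ℕ → ℝ | n * x ≤ ∑ t ∈ Finset.range (n * Q), a W t * ε (s + t)}) :=
        measureReal_mono hsub (measure_ne_top _ _)
    _ ≤ ∑ W ∈ (Finset.range Q).powerset, v.noiseLaw.real
        {ε : ℕ → ℝ | n * x ≤ ∑ t ∈ Finset.range (n * Q), a W t * ε (s + t)} :=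
        measureReal_biUnion_finset_le _ _
    _ ≤ ∑ W ∈ (Finset.range Q).powerset, Real.exp (-(n * x) ^ 2 / (2 * (n * Q : ℕ) * σ ^ 2)) := by
        refine Finset.sum_le_sum fun W _ => noiseLaw_signed_sum_ge_le hv _ (fun t => ?_) _ _
          (by positivity)
        by_cases h : t / n ∈ W <;> simp [a, h]
    _ = _ := by
        have : -((n : ℝ) * x) ^ 2 / (2 * (n * Q : ℕ) * σ ^ 2) =
            -(n * x ^ 2) / (2 * Q * σ ^ 2) := by
          push_cast
          rw [show -((n : ℝ) * x) ^ 2 = n * (-(n * x ^ 2)) by ring,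
            show 2 * ((n : ℝ) * Q) * σ ^ 2 = n * (2 * Q * σ ^ 2) by ring,
            mul_div_mul_left _ _ hn'.ne']
        rw [Finset.sum_const, Finset.card_powerset, Finset.card_range, nsmul_eq_mul, this]
        simp

/-- The estimate of the change in mean is rarely too small by a factor `2`. -/
lemma noiseLaw_deltaHat_lt_le {v : Environment} {Δ σ : ℝ} (hv : v.InClass Δ σ)
    {n : ℕ} (hn : 0 < n) :
    v.noiseLaw.real {ε | deltaHat (v.reward ε) n < Δ / 2} ≤
      Real.exp (-(n * Δ ^ 2) / (16 * σ ^ 2)) := by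
  have hn' : (0 : ℝ) < n := by positivity
  have hΔ : 0 ≤ Δ := hv.1 ▸ abs_nonneg _
  have h0 : v.meanReward 0 = v.mean₁ := if_pos v.changePt_mem.1
  have h1 : v.meanReward 1 = v.mean₂ := if_neg (not_le.2 v.changePt_mem.2)
  obtain ⟨r, hr, hrΔ⟩ : ∃ r : ℝ, (r = 1 ∨ r = -1) ∧ r * (v.mean₂ - v.mean₁) = Δ := by
    rcases le_total v.mean₁ v.mean₂ with h | h
    · exact ⟨1, .inl rfl, by rw [← hv.1, abs_sub_comm, abs_of_nonneg (sub_nonneg.2 h)]; ring⟩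
    · exact ⟨-1, .inr rfl, by rw [← hv.1, abs_of_nonneg (sub_nonneg.2 h)]; ring⟩
  -- Opposite signs on the two blocks, oriented by the sign of the gap: underestimation by half
  -- pushes this signed sum of `2n` variables above `nΔ/2`.
  let a : ℕ → ℝ := fun t => if t < n then r else -r
  have hsub : {ε | deltaHat (v.reward ε) n < Δ / 2} ⊆
      {ε : ℕ → ℝ | n * (Δ / 2) ≤ ∑ t ∈ Finset.range (n + n), a t * ε (0 + t)} := by
    intro ε hε
    simp only [Set.mem_ofPred_eq, deltaHat, empMean_reward v ε _ hn, h0, h1] at hε ⊢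
    have hs : ∑ t ∈ Finset.range (n + n), a t * ε (0 + t) =
        n * (r * (noiseMean ε 0 n - noiseMean ε n n)) := by
      rw [Finset.sum_range_add]
      have e1 : ∑ t ∈ Finset.range n, a t * ε (0 + t) = r * (n * noiseMean ε 0 n) := by
        rw [noiseMean, mul_div_cancel₀ _ hn'.ne', Finset.mul_sum]
        exact Finset.sum_congr rfl fun t ht => by simp [a, Finset.mem_range.1 ht]
      have e2 : ∑ t ∈ Finset.range n, a (n + t) * ε (0 + (n + t)) =
          -r * (n * noiseMean ε n n) := by
        rw [noiseMean, mul_div_cancel₀ _ hn'.ne', Finset.mul_sum]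
        exact Finset.sum_congr rfl fun t ht => by simp [a]
      rw [e1, e2]; ring
    rw [hs]
    refine mul_le_mul_of_nonneg_left ?_ hn'.le
    have := abs_lt.1 hε
    rcases hr with rfl | rfl <;> linarith [this.1, this.2]
  refine (measureReal_mono hsub).trans
    ((noiseLaw_signed_sum_ge_le hv a (fun t => ?_) 0 (n + n) (by positivity)).trans_eq ?_)
  · rcases hr with rfl | rfl <;> by_cases h : t < n <;> simp [a, h]
  · congr 1
    push_cast
    rw [show -((n : ℝ) * (Δ / 2)) ^ 2 = n * (-(n * Δ ^ 2)) / 4 by ring,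
      show 2 * ((n : ℝ) + n) * σ ^ 2 = n * (16 * σ ^ 2) / 4 by ring,
      div_div_div_cancel_right₀ (by norm_num), mul_div_mul_left _ _ hn'.ne']

/-! ### Correct phases of SHB -/

/-- With the change between `a₁` and `a₃`, the even split sees the full gap `D` and the uneven
splits only `2D/3`, each up to `2δ`. The inequality `D - 2δ ≥ 3/4 (2D/3 + 2δ)` is exactly `7δ ≤ D`.
-/
lemma not_eventP_of_mem {μ₁ μ₂ δ e₁ e₃ ezero eone : ℝ} (hδ : 7 * δ ≤ |μ₁ - μ₂|)
    (h₁ : |e₁| ≤ δ) (h₃ : |e₃| ≤ δ) (hzero : |ezero| ≤ δ) (hone : |eone| ≤ δ) :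
    ¬ EventP (μ₁ + ezero) (μ₁ + e₁) (μ₂ + e₃) (μ₂ + eone) := by
  rw [abs_le] at h₁ h₃ hzero hone
  obtain ⟨h₁, h₁'⟩ := h₁
  obtain ⟨h₃, h₃'⟩ := h₃
  obtain ⟨hzero, hzero'⟩ := hzero
  obtain ⟨hone, hone'⟩ := hone
  rw [EventP, not_lt]
  set D := |μ₁ - μ₂| with hD
  have hD1 : μ₁ - μ₂ ≤ D := le_abs_self _
  have hD2 : -(μ₁ - μ₂) ≤ D := neg_le_abs _
  have hmax : max |((μ₁ + ezero) + (μ₁ + e₁) + (μ₂ + e₃)) / 3 - (μ₂ + eone)|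
      |(μ₁ + ezero) - ((μ₁ + e₁) + (μ₂ + e₃) + (μ₂ + eone)) / 3| ≤ 2 / 3 * D + 2 * δ := by
    refine max_le ?_ ?_ <;> rw [abs_le] <;> constructor <;> linarith
  have hA : D - 2 * δ ≤ |((μ₁ + ezero) + (μ₁ + e₁)) / 2 - ((μ₂ + e₃) + (μ₂ + eone)) / 2| := by
    rcases abs_choice (μ₁ - μ₂) with h | h <;> rw [← hD] at h
    · exact le_trans (by linarith) (le_abs_self _)
    · exact le_trans (by linarith) (neg_le_abs _)
  linarith

/-- Here the even split sees only `D/2` and one uneven split sees `D`, each up to `2δ`; `D/2 + 2δ <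
3/4 (D - 2δ)` is exactly `14δ < D`. -/
lemma eventP_of_left {μ₁ μ₂ δ e₁ e₃ ezero eone : ℝ} (hδ : 14 * δ < |μ₁ - μ₂|)
    (h₁ : |e₁| ≤ δ) (h₃ : |e₃| ≤ δ) (hzero : |ezero| ≤ δ) (hone : |eone| ≤ δ) :
    EventP (μ₁ + ezero) (μ₂ + e₁) (μ₂ + e₃) (μ₂ + eone) := by
  rw [abs_le] at h₁ h₃ hzero hone
  obtain ⟨h₁, h₁'⟩ := h₁
  obtain ⟨h₃, h₃'⟩ := h₃
  obtain ⟨hzero, hzero'⟩ := hzero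
  obtain ⟨hone, hone'⟩ := hone
  rw [EventP]
  set D := |μ₁ - μ₂| with hD
  have hD1 : μ₁ - μ₂ ≤ D := le_abs_self _
  have hD2 : -(μ₁ - μ₂) ≤ D := neg_le_abs _
  have hA : |((μ₁ + ezero) + (μ₂ + e₁)) / 2 - ((μ₂ + e₃) + (μ₂ + eone)) / 2| ≤
      D / 2 + 2 * δ := by
    rw [abs_le]; constructor <;> linarith
  have hB : D - 2 * δ ≤ |(μ₁ + ezero) - ((μ₂ + e₁) + (μ₂ + e₃) + (μ₂ + eone)) / 3| := by
    rcases abs_choice (μ₁ - μ₂) with h | h <;> rw [← hD] at h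
    · exact le_trans (by linarith) (le_abs_self _)
    · exact le_trans (by linarith) (neg_le_abs _)
  have := hB.trans (le_max_right
    |((μ₁ + ezero) + (μ₂ + e₁) + (μ₂ + e₃)) / 3 - (μ₂ + eone)| _)
  linarith

/-- Reflection symmetry, which reduces a change point right of the region to one left of it. -/
lemma eventP_comm (a b c d : ℝ) : EventP a b c d ↔ EventP d c b a := by
  unfold EventP
  rw [show (d + c) / 2 - (b + a) / 2 = -((a + b) / 2 - (c + d) / 2) by ring,
    show (d + c + b) / 3 - a = -(a - (b + c + d) / 3) by ring,
    show d - (c + b + a) / 3 = -((a + b + c) / 3 - d) by ring, abs_neg, abs_neg, abs_neg, max_comm]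

lemma eventP_of_right {μ₁ μ₂ δ e₁ e₃ ezero eone : ℝ} (hδ : 14 * δ < |μ₁ - μ₂|)
    (h₁ : |e₁| ≤ δ) (h₃ : |e₃| ≤ δ) (hzero : |ezero| ≤ δ) (hone : |eone| ≤ δ) :
    EventP (μ₁ + ezero) (μ₁ + e₁) (μ₁ + e₃) (μ₂ + eone) := by
  have := eventP_of_left (μ₁ := μ₂) (μ₂ := μ₁) (by rwa [abs_sub_comm]) h₃ h₁ hone hzero
  exact (eventP_comm _ _ _ _).1 this

lemma eventR_of_right {μ₁ μ₂ δ e₁ e₂ e₃ : ℝ} (hδ : 4 * δ < |μ₁ - μ₂|)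
    (h₁ : |e₁| ≤ δ) (h₂ : |e₂| ≤ δ) (h₃ : |e₃| ≤ δ) :
    EventR (μ₁ + e₁) (μ₁ + e₂) (μ₂ + e₃) := by
  rw [EventR]
  have := abs_sub_le (μ₁ + e₁) μ₁ (μ₁ + e₂)
  have := abs_add_three (μ₁ + e₂ - (μ₂ + e₃)) (-e₂) e₃
  rw [show μ₁ + e₂ - (μ₂ + e₃) + -e₂ + e₃ = μ₁ - μ₂ by ring, abs_neg] at this
  simp only [add_sub_cancel_left, sub_add_cancel_left, abs_neg] at *
  linarith

lemma not_eventR_of_left {μ₁ μ₂ δ e₁ e₂ e₃ : ℝ} (hδ : 4 * δ < |μ₁ - μ₂|)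
    (h₁ : |e₁| ≤ δ) (h₂ : |e₂| ≤ δ) (h₃ : |e₃| ≤ δ) :
    ¬ EventR (μ₁ + e₁) (μ₂ + e₂) (μ₂ + e₃) := by
  have := eventR_of_right (μ₁ := μ₂) (μ₂ := μ₁) (by rwa [abs_sub_comm]) h₃ h₂ h₁
  rw [EventR, abs_sub_comm, abs_sub_comm (μ₂ + e₂) (μ₁ + e₁)] at this
  exact this.not_gt

/-! ### The walk of SHB on the tree of regions -/

/-- The change point lies in the current region. -/
def Environment.Inside (v : Environment) (h : List Bool) : Prop :=
  (pointsOf h).a₁ ≤ v.changePt ∧ v.changePt < (pointsOf h).a₃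

lemma a₂_pointsOf (h : List Bool) :
    (pointsOf h).a₂ = ((pointsOf h).a₁ + (pointsOf h).a₃) / 2 := by
  rcases h with _ | ⟨_ | _, h⟩ <;> simp [pointsOf, Points.init, Points.zoomL, Points.zoomR]

lemma a₃_sub_a₁_pointsOf (h : List Bool) :
    (pointsOf h).a₃ - (pointsOf h).a₁ = 2⁻¹ ^ h.length := by
  induction h with
  | nil => simp [pointsOf, Points.init]
  | cons b h ih =>
    have := a₂_pointsOf h
    rcases b <;> simp only [pointsOf, Points.zoomL, Points.zoomR, List.length_cons, pow_succ] <;>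
      linarith

lemma a₁_lt_a₃_pointsOf (h : List Bool) : (pointsOf h).a₁ < (pointsOf h).a₃ := by
  have := a₃_sub_a₁_pointsOf h
  have : (0 : ℝ) < 2⁻¹ ^ h.length := by positivity
  linarith

lemma pointsOf_cons_subset (b : Bool) (h : List Bool) :
    (pointsOf h).a₁ ≤ (pointsOf (b :: h)).a₁ ∧ (pointsOf (b :: h)).a₃ ≤ (pointsOf h).a₃ := by
  have := a₂_pointsOf h
  have := a₁_lt_a₃_pointsOf h
  rcases b <;> simp only [pointsOf, Points.zoomL, Points.zoomR] <;> constructor <;> linarith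

lemma Environment.inside_nil (v : Environment) : v.Inside [] := by
  simpa [Environment.Inside, pointsOf, Points.init] using v.changePt_mem

lemma Environment.Inside.of_cons {v : Environment} {b : Bool} {h : List Bool}
    (hb : v.Inside (b :: h)) : v.Inside h :=
  ⟨(pointsOf_cons_subset b h).1.trans hb.1, hb.2.trans_le (pointsOf_cons_subset b h).2⟩

open Classical in
/-- The number of zooms in force that lead to a region containing the change point, minus the
number of the other ones. -/
noncomputable def Environment.progress (v : Environment) : List Bool → ℤ
  | [] => 0
  | b :: h => if v.Inside (b :: h) then v.progress h + 1 else v.progress h - 1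

lemma Environment.progress_cons_of_inside {v : Environment} {b : Bool} {h : List Bool}
    (hb : v.Inside (b :: h)) : v.progress (b :: h) = v.progress h + 1 := if_pos hb

lemma Environment.progress_cons_of_not_inside {v : Environment} {b : Bool} {h : List Bool}
    (hb : ¬ v.Inside (b :: h)) : v.progress (b :: h) = v.progress h - 1 := if_neg hb

lemma Environment.sub_one_le_progress_cons (v : Environment) (b : Bool) (h : List Bool) :
    v.progress h - 1 ≤ v.progress (b :: h) := by
  rw [Environment.progress]; split_ifs <;> omega

lemma Environment.sub_one_le_progress_tail (v : Environment) (h : List Bool) :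
    v.progress h - 1 ≤ v.progress h.tail := by
  rcases h with _ | ⟨b, h⟩
  · simp
  · rw [Environment.progress, List.tail_cons]; split_ifs <;> omega

/-- Regions are nested, so if the current one contains the change point, every zoom in force was
correct. -/
lemma Environment.Inside.progress_eq {v : Environment} {h : List Bool} (hh : v.Inside h) :
    v.progress h = h.length := by
  induction h with
  | nil => simp [Environment.progress]
  | cons b h ih => simp [Environment.progress_cons_of_inside hh, ih hh.of_cons]

lemma Environment.progress_tail_of_not_inside {v : Environment} {h : List Bool}
    (hh : ¬ v.Inside h) : v.progress h.tail = v.progress h + 1 := by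
  rcases h with _ | ⟨b, h⟩
  · exact absurd v.inside_nil hh
  · rw [Environment.progress_cons_of_not_inside hh]; simp

lemma Environment.Inside.abs_sub_le {v : Environment} {h : List Bool} (hh : v.Inside h) {x : ℝ}
    (h₁ : (pointsOf h).a₁ ≤ x) (h₃ : x ≤ (pointsOf h).a₃) :
    |x - v.changePt| ≤ 2⁻¹ ^ v.progress h := by
  rw [hh.progress_eq, zpow_natCast, ← a₃_sub_a₁_pointsOf, abs_le]
  constructor <;> linarith [hh.1, hh.2]

/-- The last region on the path that contains the change point has progress equal to its depth.
Every later zoom is wrong and costs one, so that depth is at least the current progress plus one,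
and the current region lies in that ancestor. -/
lemma Environment.abs_sub_le_of_not_inside {v : Environment} {h : List Bool} (hh : ¬ v.Inside h)
    {x : ℝ} (h₁ : (pointsOf h).a₁ ≤ x) (h₃ : x ≤ (pointsOf h).a₃) :
    |x - v.changePt| ≤ 2⁻¹ ^ (v.progress h + 1) := by
  induction h with
  | nil => exact absurd v.inside_nil hh
  | cons b h ih =>
    have h₁' := (pointsOf_cons_subset b h).1.trans h₁
    have h₃' := h₃.trans (pointsOf_cons_subset b h).2
    rw [Environment.progress_cons_of_not_inside hh, sub_add_cancel]
    by_cases h' : v.Inside h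
    · exact h'.abs_sub_le h₁' h₃'
    · refine (ih h' h₁' h₃').trans ?_
      rw [zpow_add_one₀ (by norm_num)]
      have : (0 : ℝ) < 2⁻¹ ^ v.progress h := by positivity
      linarith

lemma Environment.abs_a₂_sub_changePt_le (v : Environment) (h : List Bool) :
    |(pointsOf h).a₂ - v.changePt| ≤ 2⁻¹ ^ (v.progress h + 1) := by
  have h13 := a₁_lt_a₃_pointsOf h
  by_cases hh : v.Inside h
  · rw [hh.progress_eq, zpow_add_one₀ (by norm_num), zpow_natCast, ← a₃_sub_a₁_pointsOf,
      a₂_pointsOf, abs_le]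
    constructor <;> linarith [hh.1, hh.2]
  · exact v.abs_sub_le_of_not_inside hh (by rw [a₂_pointsOf]; linarith)
      (by rw [a₂_pointsOf]; linarith)

lemma Environment.meanReward_of_le {v : Environment} {x : ℝ} (h : x ≤ v.changePt) :
    v.meanReward x = v.mean₁ := if_pos h

lemma Environment.meanReward_of_lt {v : Environment} {x : ℝ} (h : v.changePt < x) :
    v.meanReward x = v.mean₂ := if_neg (not_le.2 h)

lemma sub_one_le_progress_shbStep (v : Environment) (y : ℕ → ℝ → ℝ) (s n : ℕ) (h : List Bool) :
    v.progress h - 1 ≤ v.progress (shbStep y s n h) := by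
  unfold shbStep
  dsimp only
  split_ifs
  · exact v.sub_one_le_progress_tail h
  · exact v.sub_one_le_progress_cons _ h
  · exact v.sub_one_le_progress_cons _ h

/-- A phase in which all noise averages are small makes progress. -/
lemma progress_shbStep (v : Environment) (ε : ℕ → ℝ) (s : ℕ) {n : ℕ} (hn : 0 < n)
    (h : List Bool) {δ : ℝ} (hδ : 14 * δ < |v.mean₁ - v.mean₂|)
    (hε : ∀ k < 5, |noiseMean ε (s + k * n) n| ≤ δ) :
    v.progress (shbStep (v.reward ε) s n h) = v.progress h + 1 := by
  have e0 := hε 0 (by norm_num)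
  have e1 := hε 1 (by norm_num)
  have e2 := hε 2 (by norm_num)
  have e3 := hε 3 (by norm_num)
  have e4 := hε 4 (by norm_num)
  rw [zero_mul, add_zero] at e0
  rw [one_mul] at e1
  have hδ0 : 0 ≤ δ := (abs_nonneg _).trans e0
  have f0 : v.meanReward 0 = v.mean₁ := v.meanReward_of_le v.changePt_mem.1
  have f1 : v.meanReward 1 = v.mean₂ := v.meanReward_of_lt v.changePt_mem.2
  have h13 := a₁_lt_a₃_pointsOf h
  unfold shbStep
  dsimp only
  rw [empMean_reward v ε _ hn, empMean_reward v ε _ hn, empMean_reward v ε _ hn,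
    empMean_reward v ε _ hn, empMean_reward v ε _ hn, f0, f1]
  by_cases hh : v.Inside h
  · rw [v.meanReward_of_le hh.1, v.meanReward_of_lt hh.2,
      if_neg (not_eventP_of_mem (by linarith) e0 e2 e3 e4)]
    by_cases h2 : (pointsOf h).a₂ ≤ v.changePt
    · rw [v.meanReward_of_le h2, if_pos (eventR_of_right (by linarith) e0 e1 e2)]
      exact v.progress_cons_of_inside ⟨h2, hh.2⟩
    · rw [v.meanReward_of_lt (not_le.1 h2), if_neg (not_eventR_of_left (by linarith) e0 e1 e2)]
      exact v.progress_cons_of_inside ⟨hh.1, not_le.1 h2⟩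
  · rw [← v.progress_tail_of_not_inside hh]
    by_cases h1 : (pointsOf h).a₁ ≤ v.changePt
    · have h3 : (pointsOf h).a₃ ≤ v.changePt := not_lt.1 fun h3 => hh ⟨h1, h3⟩
      rw [v.meanReward_of_le h1, v.meanReward_of_le h3, if_pos (eventP_of_right hδ e0 e2 e3 e4)]
    · have h1 := not_le.1 h1
      rw [v.meanReward_of_lt h1, v.meanReward_of_lt (h1.trans h13),
        if_pos (eventP_of_left hδ e0 e2 e3 e4)]

/-- SHB makes progress up to the total size of the noise averages. -/
lemma le_progress_shbState (v : Environment) (ε : ℕ → ℝ) (s : ℕ) {n : ℕ} (hn : 0 < n) (j : ℕ) :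
    j - 32 / |v.mean₁ - v.mean₂| * ∑ q ∈ Finset.range (5 * j), |noiseMean ε (s + n * q) n| ≤
      (v.progress (shbState (v.reward ε) s n j) : ℝ) := by
  set Δ := |v.mean₁ - v.mean₂| with hΔ
  have hΔ0 : 0 < Δ := abs_pos.2 (sub_ne_zero.2 v.mean_ne)
  induction j with
  | zero => simp [shbState, Environment.progress]
  | succ j ih =>
    rw [Nat.mul_succ, Finset.sum_range_add, shbState]
    set h := shbState (v.reward ε) s n j
    set S := ∑ k ∈ Finset.range 5, |noiseMean ε (s + n * (5 * j + k)) n| with hS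
    have hS0 : 0 ≤ S := Finset.sum_nonneg fun _ _ => abs_nonneg _
    -- Below `Δ/16` the phase is good, since `14/16 < 1`. Above it the penalty `32S/Δ` exceeds `2`,
    -- the difference between the expected gain of one and the worst loss of one.
    by_cases hc : S ≤ Δ / 16
    · have := progress_shbStep v ε (s + 5 * n * j) hn h (δ := Δ / 16) (by linarith) fun k hk => by
        refine le_trans ?_ hc
        rw [show s + 5 * n * j + k * n = s + n * (5 * j + k) by ring]
        exact Finset.single_le_sum
          (f := fun k => |noiseMean ε (s + n * (5 * j + k)) n|)
          (fun _ _ => abs_nonneg _) (Finset.mem_range.2 hk)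
      rw [this]
      have : 0 ≤ 32 / Δ * S := by positivity
      push_cast
      linarith
    · have := sub_one_le_progress_shbStep v (v.reward ε) (s + 5 * n * j) n h
      have : (v.progress h : ℝ) - 1 ≤
        v.progress (shbStep (v.reward ε) (s + 5 * n * j) n h) := by exact_mod_cast this
      have : 2 ≤ 32 / Δ * S := by
        rw [div_mul_eq_mul_div, le_div_iff₀ hΔ0]; linarith
      push_cast
      linarith

/-- SHB fails only if the noise averages are large in total. -/
lemma le_sum_abs_noiseMean_of_le_abs_SHB_sub (v : Environment) (ε : ℕ → ℝ) (s : ℕ) {n N : ℕ}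
    (hn : 0 < n) {η : ℝ} (hη : 0 < η) (hN : 4 * Real.logb 2 (1 / (2 * η)) ≤ N)
    (hfail : η ≤ |(pointsOf (shbState (v.reward ε) s n N)).a₂ - v.changePt|) :
    |v.mean₁ - v.mean₂| * N / 64 ≤
      ∑ q ∈ Finset.range (5 * N), |noiseMean ε (s + n * q) n| := by
  set Δ := |v.mean₁ - v.mean₂| with hΔ
  have hΔ0 : 0 < Δ := abs_pos.2 (sub_ne_zero.2 v.mean_ne)
  have h1 := le_progress_shbState v ε s hn N
  have h2 := hfail.trans (v.abs_a₂_sub_changePt_le _)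
  set p := v.progress (shbState (v.reward ε) s n N)
  -- Failure means `η ≤ 2^-(p + 1)`, which bounds the final progress by `log₂ (1/(2η)) ≤ N/4`; the
  -- noise therefore has to pay for at least half of the phases.
  have h3 : (p : ℝ) ≤ Real.logb 2 (1 / (2 * η)) := by
    rw [Real.le_logb_iff_rpow_le (by norm_num) (by positivity), Real.rpow_intCast,
      le_div_iff₀ (by positivity)]
    rw [zpow_add_one₀ (by norm_num), inv_zpow] at h2
    have : (0 : ℝ) < 2 ^ p := by positivity
    calc (2 : ℝ) ^ p * (2 * η) ≤ 2 ^ p * (2 * (((2 : ℝ) ^ p)⁻¹ * 2⁻¹)) := by gcongr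
      _ = 1 := by field_simp
  rw [← hΔ] at h1
  set S := ∑ q ∈ Finset.range (5 * N), |noiseMean ε (s + n * q) n|
  have hN0 : (0 : ℝ) ≤ N := by positivity
  have h4 : (N : ℝ) / 2 ≤ 32 / Δ * S := by linarith
  rw [div_mul_eq_mul_div, le_div_iff₀ hΔ0] at h4
  linarith

/-! ### Failure probabilities -/

lemma Environment.InClass.pos {v : Environment} {Δ σ : ℝ} (hv : v.InClass Δ σ) : 0 < Δ :=
  hv.1 ▸ abs_pos.2 (sub_ne_zero.2 v.mean_ne)

lemma logb_two_pos {η : ℝ} (hη : 0 < η) (hη2 : η < 1 / 2) : 0 < Real.logb 2 (1 / (2 * η)) :=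
  Real.logb_pos (by norm_num) (by rw [lt_div_iff₀ (by positivity)]; linarith)

lemma log_eq_mul_logb (x : ℝ) : Real.log x = Real.logb 2 x * Real.log 2 := by
  rw [Real.logb, div_mul_cancel₀ _ (Real.log_pos (by norm_num)).ne']

lemma shbPhases_pos {η : ℝ} (hη : 0 < η) (hη2 : η < 1 / 2) : 0 < shbPhases η := by
  rw [shbPhases, Nat.ceil_pos, log_eq_mul_logb]
  have := logb_two_pos hη hη2
  have := Real.log_pos (show (1 : ℝ) < 2 by norm_num)
  positivity

/-- This is where the factor `6` in the number of phases enters: `6 log 2 > 4`. -/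
lemma four_mul_logb_le_shbPhases {η : ℝ} (hη : 0 < η) (hη2 : η < 1 / 2) :
    4 * Real.logb 2 (1 / (2 * η)) ≤ shbPhases η := by
  refine le_trans ?_ (Nat.le_ceil _)
  rw [log_eq_mul_logb]
  nlinarith [logb_two_pos hη hη2, Real.log_two_gt_d9]

lemma shbPhases_le {η : ℝ} (hη : 0 < η) (hη2 : η < 1 / 2) :
    (shbPhases η : ℝ) ≤ 5 * Real.logb 2 (1 / (2 * η)) + 1 := by
  have h0 := logb_two_pos hη hη2
  have h1 : 6 * Real.log (1 / (2 * η)) ≤ 5 * Real.logb 2 (1 / (2 * η)) := by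
    rw [log_eq_mul_logb]
    nlinarith [Real.log_two_lt_d9]
  have h2 : 0 ≤ 6 * Real.log (1 / (2 * η)) := by
    rw [log_eq_mul_logb]
    have := Real.log_pos (show (1 : ℝ) < 2 by norm_num)
    positivity
  have := Nat.ceil_lt_add_one h2
  rw [shbPhases]
  linarith

lemma half_le_floor {x : ℝ} (hx : 1 ≤ x) : x / 2 ≤ ⌊x⌋₊ := by
  have h1 := Nat.lt_floor_add_one x
  have h2 : (1 : ℝ) ≤ ⌊x⌋₊ := by exact_mod_cast (Nat.one_le_floor_iff x).2 hx
  linarith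

/-- The sign patterns cost `2^(5N) ≤ exp (4N)`. Hoeffding's exponent is `nNΔ²/(40960σ²)` with `40960
= 2 · 5 · 64²`, and rounding down in `n` still leaves `nN ≥ b/10`. -/
lemma noiseLaw_SHB_fail_le {v : Environment} {Δ σ η b : ℝ} (hv : v.InClass Δ σ) (hσ : 0 < σ)
    (hη : 0 < η) (hη2 : η < 1 / 2) (s : ℕ) (hb : 5 * (shbPhases η : ℝ) ≤ b) :
    v.noiseLaw.real {ε | η ≤ |SHB (v.reward ε) s b η - v.changePt|} ≤
      Real.exp (4 * shbPhases η - b * Δ ^ 2 / (409600 * σ ^ 2)) := by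
  have hΔ := hv.pos
  set N := shbPhases η with hN
  have hN0 : (0 : ℝ) < N := by exact_mod_cast shbPhases_pos hη hη2
  set n := ⌊b / (5 * N)⌋₊ with hn
  have h1 : 1 ≤ b / (5 * N) := by rwa [le_div_iff₀ (by positivity), one_mul]
  have hn0 : 0 < n := Nat.floor_pos.2 h1
  have hn1 : b / 10 ≤ n * N := by
    have := half_le_floor h1
    calc b / 10 = b / (5 * N) / 2 * N := by field_simp; ring
      _ ≤ n * N := by gcongr
  have hsub : {ε | η ≤ |SHB (v.reward ε) s b η - v.changePt|} ⊆
      {ε | Δ * N / 64 ≤ ∑ q ∈ Finset.range (5 * N), |noiseMean ε (s + n * q) n|} := by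
    intro ε hε
    rw [Set.mem_ofPred_eq, ← hv.1]
    exact le_sum_abs_noiseMean_of_le_abs_SHB_sub v ε s hn0 hη (four_mul_logb_le_shbPhases hη hη2) hε
  refine (measureReal_mono hsub).trans
    ((noiseLaw_sum_abs_noiseMean_ge_le hv s (5 * N) hn0 (by positivity)).trans ?_)
  have h2 : (2 : ℝ) ^ (5 * N) ≤ Real.exp (4 * N) := by
    rw [← Real.exp_log (show (0 : ℝ) < 2 ^ (5 * N) by positivity), Real.log_pow]
    refine Real.exp_le_exp.2 ?_
    push_cast
    nlinarith [Real.log_two_lt_d9]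
  have h3 : -(n * (Δ * N / 64) ^ 2) / (2 * (5 * N : ℕ) * σ ^ 2) ≤
      -(b * Δ ^ 2 / (409600 * σ ^ 2)) := by
    calc -(n * (Δ * N / 64) ^ 2) / (2 * (5 * N : ℕ) * σ ^ 2)
        = -((n * N) * Δ ^ 2 / (40960 * σ ^ 2)) := by push_cast; field_simp; norm_num
      _ ≤ -((b / 10) * Δ ^ 2 / (40960 * σ ^ 2)) := by gcongr
      _ = _ := by ring
  rw [sub_eq_add_neg, Real.exp_add]
  gcongr

/-- If the change in mean is not underestimated by a factor `2` and the budget is large, then SHA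
runs SHB. -/
lemma SHA_eq_SHB {y : ℕ → ℝ → ℝ} {γ L η σ T Δ : ℝ} (hΔ : 0 < Δ) (hη : 0 < η) (hη2 : η < 1 / 2)
    (hγ : 0 ≤ γ) (hT : 4 * γ * σ ^ 2 * Real.log (1 / (2 * η)) ≤ Δ ^ 2 * T)
    (hD : Δ / 2 ≤ deltaHat y ⌊L / 2⌋₊) :
    SHA y γ L η σ T = SHB y (2 * ⌊L / 2⌋₊) (T - L) η := by
  have hD0 : 0 < deltaHat y ⌊L / 2⌋₊ := by linarith
  refine if_pos ⟨hD0.ne', ?_⟩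
  have hlog : 0 ≤ Real.log (1 / (2 * η)) := by
    rw [log_eq_mul_logb]
    exact mul_nonneg (logb_two_pos hη hη2).le (Real.log_nonneg (by norm_num))
  rw [threshold]
  calc γ * (σ ^ 2 / deltaHat y ⌊L / 2⌋₊ ^ 2) * Real.log (1 / (2 * η))
      ≤ γ * (σ ^ 2 / (Δ / 2) ^ 2) * Real.log (1 / (2 * η)) := by gcongr
    _ = 4 * γ * σ ^ 2 * Real.log (1 / (2 * η)) / Δ ^ 2 := by ring
    _ ≤ T := by rw [div_le_iff₀ (by positivity)]; linarith

lemma failProbSHA_le_one (v : Environment) (γ L η σ T : ℝ) : v.failProbSHA γ L η σ T ≤ 1 :=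
  measureReal_le_one

/-- Either `Δ` is underestimated by more than a factor `2`, or SHB runs and fails. A union bound
needs no conditioning on the estimate. -/
lemma failProbSHA_le_add {v : Environment} {γ L η σ T Δ : ℝ} (hv : v.InClass Δ σ) (hσ : 0 < σ)
    (hη : 0 < η) (hη2 : η < 1 / 2) (hγ : 0 ≤ γ) (hL : 2 ≤ L)
    (hb : 5 * (shbPhases η : ℝ) ≤ T - L)
    (hT : 4 * γ * σ ^ 2 * Real.log (1 / (2 * η)) ≤ Δ ^ 2 * T) :
    v.failProbSHA γ L η σ T ≤ Real.exp (-(L * Δ ^ 2 / (64 * σ ^ 2))) +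
      Real.exp (4 * shbPhases η - (T - L) * Δ ^ 2 / (409600 * σ ^ 2)) := by
  have hΔ := hv.pos
  have hL1 : 1 ≤ L / 2 := by linarith
  have hn0 : 0 < ⌊L / 2⌋₊ := Nat.floor_pos.2 hL1
  have hsub : {ε | η ≤ |SHA (v.reward ε) γ L η σ T - v.changePt|} ⊆
      {ε | deltaHat (v.reward ε) ⌊L / 2⌋₊ < Δ / 2} ∪
        {ε | η ≤ |SHB (v.reward ε) (2 * ⌊L / 2⌋₊) (T - L) η - v.changePt|} := by
    intro ε hε
    rcases lt_or_ge (deltaHat (v.reward ε) ⌊L / 2⌋₊) (Δ / 2) with hD | hD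
    · exact .inl hD
    · right
      rw [Set.mem_ofPred_eq] at hε ⊢
      rwa [SHA_eq_SHB hΔ hη hη2 hγ hT hD] at hε
  refine (measureReal_mono hsub).trans ((measureReal_union_le _ _).trans (add_le_add ?_ ?_))
  · refine (noiseLaw_deltaHat_lt_le hv hn0).trans (Real.exp_le_exp.2 ?_)
    have := half_le_floor hL1
    calc -(⌊L / 2⌋₊ * Δ ^ 2) / (16 * σ ^ 2) = -(⌊L / 2⌋₊ * Δ ^ 2 / (16 * σ ^ 2)) := neg_div ..
      _ ≤ -(L / 2 / 2 * Δ ^ 2 / (16 * σ ^ 2)) := by gcongr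
      _ = _ := by field_simp; norm_num
  · exact noiseLaw_SHB_fail_le hv hσ hη hη2 _ hb

/-- Below the budget `T₁` the exponent is bounded, so the bound for small budgets holds. -/
lemma failProbSHA_le_of_lt_budgetT₁ {v : Environment} {γ B η σ T Δ : ℝ} (hv : v.InClass Δ σ)
    (hσ : 0 < σ) (hη : 0 < η) (hη2 : η < 1 / 2) (hB0 : 0 ≤ B) (hT0 : 0 ≤ T)
    (hT : T < budgetT₁ Δ σ η) :
    v.failProbSHA γ (B * T) η σ T ≤ 4 * (⌈Real.logb 2 (1 / (2 * η))⌉₊ : ℝ) *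
      Real.exp (-(1 / 2) * (1 - B) * Δ ^ 2 * T / (σ ^ 2 * Real.logb 2 (1 / (2 * η)))) := by
  have hΔ := hv.pos
  have hl := logb_two_pos hη hη2
  have hK : 1 ≤ 1 / (2 * η) := by rw [le_div_iff₀ (by positivity)]; linarith
  have hfl : Real.log (⌊1 / (2 * η)⌋₊ : ℝ) ≤ Real.logb 2 (1 / (2 * η)) * Real.log 2 := by
    rw [← log_eq_mul_logb]
    exact Real.log_le_log (by exact_mod_cast Nat.floor_pos.2 hK) (Nat.floor_le (by linarith))
  set l := Real.logb 2 (1 / (2 * η)) with hldef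
  -- `1.59 log 2 < 1.2`; with `c₁ = 1/2` the exponent is then at least `-0.6`, and `4 (1 - 0.6) ≥ 1`
  -- makes the bound trivial.
  have hR : Δ ^ 2 * T ≤ σ ^ 2 * (1.2 * l) := by
    rw [budgetT₁, div_mul_eq_mul_div, lt_div_iff₀ (by positivity)] at hT
    rw [mul_comm]
    refine hT.le.trans (mul_le_mul_of_nonneg_left ?_ (sq_nonneg σ))
    nlinarith [Real.log_two_lt_d9, Real.log_two_gt_d9]
  have hexp : -0.6 ≤ -(1 / 2) * (1 - B) * Δ ^ 2 * T / (σ ^ 2 * l) := by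
    rw [le_div_iff₀ (by positivity)]
    have : (1 - B) * (Δ ^ 2 * T) ≤ 1 * (Δ ^ 2 * T) := by gcongr; linarith
    linarith
  have hceil : (1 : ℝ) ≤ ⌈l⌉₊ := by exact_mod_cast Nat.ceil_pos.2 hl
  have h1 := Real.add_one_le_exp (-(1 / 2) * (1 - B) * Δ ^ 2 * T / (σ ^ 2 * l))
  refine (failProbSHA_le_one _ _ _ _ _ _).trans ?_
  nlinarith

lemma failProbSHA_le_exp {v : Environment} {γ B η σ T Δ : ℝ} (hv : v.InClass Δ σ)
    (hσ : 0 < σ) (hη : 0 < η) (hη2 : η < 1 / 2) (hB0 : 0 ≤ B) (hB1 : B < 1)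
    (hL : 2 ≤ B * T) (hγ0 : 0 ≤ γ) (hγ : γ ≤ 1800 / (1 - B))
    (hb : 5 * (shbPhases η : ℝ) ≤ T - B * T) :
    v.failProbSHA γ (B * T) η σ T ≤
      5 * Real.exp (-(1 / 1638400 * B * (1 - B) * Δ ^ 2 / σ ^ 2) * T +
        5 * Real.logb 2 (1 / (2 * η))) := by
  have hΔ := hv.pos
  have hl := logb_two_pos hη hη2
  have hN := shbPhases_le hη hη2
  have hlog := log_eq_mul_logb (1 / (2 * η))
  set l := Real.logb 2 (1 / (2 * η)) with hldef
  have hT0 : 0 ≤ T := by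
    by_contra h
    nlinarith
  set R := Δ ^ 2 / σ ^ 2 * T with hR
  have hR0 : 0 ≤ R := by positivity
  have hΔT : Δ ^ 2 * T = σ ^ 2 * R := by rw [hR]; field_simp
  have hE : -(1 / 1638400 * B * (1 - B) * Δ ^ 2 / σ ^ 2) * T = -(B * (1 - B) * R / 1638400) := by
    rw [hR]; ring
  have hBB : 0 ≤ B * ((1 - B) * R) := mul_nonneg hB0 (mul_nonneg (by linarith) hR0)
  have hBB1 : B * ((1 - B) * R) ≤ (1 - B) * R :=
    mul_le_of_le_one_left (mul_nonneg (by linarith) hR0) hB1.le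
  have hBB2 : B * ((1 - B) * R) ≤ B * R := by
    have : (1 - B) * R ≤ R := mul_le_of_le_one_left hR0 (by linarith)
    gcongr
  rw [hE]
  -- The value `7200 = 4 · 1800` combines the limit on `γ` with the square of the factor `2` lost in
  -- estimating `Δ`. Below it the right-hand side is at least one.
  by_cases hc : (1 - B) * R ≤ 7200 * Real.log (1 / (2 * η))
  · refine (failProbSHA_le_one _ _ _ _ _ _).trans ?_
    have h1 : 0 ≤ -(B * (1 - B) * R / 1638400) + 5 * l := by
      rw [hlog] at hc
      nlinarith [Real.log_two_lt_d9]
    linarith [Real.one_le_exp h1]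
  · have hlog0 : 0 ≤ Real.log (1 / (2 * η)) := by
      rw [hlog]
      exact mul_nonneg hl.le (Real.log_nonneg (by norm_num))
    have hγR : 4 * γ * Real.log (1 / (2 * η)) ≤ R := by
      have hB1' : 0 < 1 - B := by linarith
      calc 4 * γ * Real.log (1 / (2 * η))
          ≤ 4 * (1800 / (1 - B)) * Real.log (1 / (2 * η)) := by gcongr
        _ = 7200 * Real.log (1 / (2 * η)) / (1 - B) := by ring
        _ ≤ R := by rw [div_le_iff₀ hB1', mul_comm R]; exact (not_le.1 hc).le
    have hmain := failProbSHA_le_add (T := T) hv hσ hη hη2 hγ0 hL hb (by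
      rw [hΔT]
      calc 4 * γ * σ ^ 2 * Real.log (1 / (2 * η))
          = σ ^ 2 * (4 * γ * Real.log (1 / (2 * η))) := by ring
        _ ≤ _ := by gcongr)
    have e1 : B * T * Δ ^ 2 / (64 * σ ^ 2) = B * R / 64 := by rw [hR]; ring
    have e2 : (T - B * T) * Δ ^ 2 / (409600 * σ ^ 2) = (1 - B) * R / 409600 := by rw [hR]; ring
    rw [e1, e2] at hmain
    set E := -(B * (1 - B) * R / 1638400) + 5 * l with hEdef
    have hone := failProbSHA_le_one v γ (B * T) η σ T
    have h1 : Real.exp (-(B * R / 64)) ≤ Real.exp E := Real.exp_le_exp.2 (by rw [hEdef]; linarith)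
    set X := 4 * shbPhases η - (1 - B) * R / 409600 with hX
    -- This fixes the constants: `1638400 = 4 · 409600`, and `4N ≤ 4 (5l + 1)` since `N ≤ 5l + 1`.
    have h2 : X ≤ 4 * (E + 1) := by rw [hX, hEdef]; linarith
    have h3 : Real.exp (E + 1) ≤ 3 * Real.exp E := by
      rw [Real.exp_add, mul_comm]
      gcongr
      linarith [Real.exp_one_lt_d9]
    have hE0 := Real.exp_pos E
    -- If `E + 1 ≥ 0`, then `3 exp E ≥ 1` and the bound is trivial. Otherwise `X ≤ E + 1`, and the
    -- two failure events contribute `1` and `3` times `exp E`.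
    rcases le_total 0 (E + 1) with h | h
    · linarith [Real.one_le_exp h]
    · have : Real.exp X ≤ Real.exp (E + 1) := Real.exp_le_exp.2 (by linarith)
      linarith

end ChangePoint

theorem theorem5 :
    ∃ c₁ c₂ c₃ : ℝ, 0 < c₁ ∧ 0 < c₂ ∧ 0 < c₃ ∧
      ∀ (T : ℕ) (B γ η σ Δ : ℝ) (v : ChangePoint.Environment),
        0 < η → η < 1 / 2 → 0 < σ →
        v.InClass Δ σ →
        B ∈ Set.Ioo (2 / (T : ℝ)) (1 - 2 / (T : ℝ)) →
        γ ∈ Set.Ioo ((√(104 / B) + √1.59) ^ 2) (1800 / (1 - B)) →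
        -- SHB, and therefore also SH, plays every action at least once in every phase
        5 * (ChangePoint.shbPhases η : ℝ) ≤ T - B * T →
        ((T : ℝ) < ChangePoint.budgetT₁ Δ σ η →
          v.failProbSHA γ (B * T) η σ T ≤
            4 * (⌈Real.logb 2 (1 / (2 * η))⌉₊ : ℝ) *
              Real.exp (-c₁ * (1 - B) * Δ ^ 2 * T / (σ ^ 2 * Real.logb 2 (1 / (2 * η))))) ∧
        (ChangePoint.budgetT₁ Δ σ η ≤ (T : ℝ) →
          v.failProbSHA γ (B * T) η σ T ≤
            5 * Real.exp (-(c₂ * B * (1 - B) * Δ ^ 2 / σ ^ 2) * T +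
              c₃ * Real.logb 2 (1 / (2 * η)))) := by
  refine ⟨1 / 2, 1 / 1638400, 5, by norm_num, by norm_num, by norm_num, ?_⟩
  intro T B γ η σ Δ v hη hη2 hσ hv hB hγ hb
  -- At `T = 0` the quotient `2 / T` is `0`, so the interval for `B` does not exclude this case; the
  -- budget condition does, because there is at least one phase.
  have hT0 : (0 : ℝ) < T := by
    refine lt_of_le_of_ne (Nat.cast_nonneg T) fun h => ?_
    rw [← h] at hb
    have : (0 : ℝ) < ChangePoint.shbPhases η := by exact_mod_cast ChangePoint.shbPhases_pos hη hη2
    linarith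
  have hT2 : 0 < 2 / (T : ℝ) := by positivity
  have hB0 : 0 ≤ B := (hT2.trans hB.1).le
  have hB1 : B < 1 := by linarith [hB.2]
  have hL : 2 ≤ B * T := ((div_lt_iff₀ hT0).1 hB.1).le
  exact ⟨fun hT => ChangePoint.failProbSHA_le_of_lt_budgetT₁ hv hσ hη hη2 hB0 hT0.le hT,
    fun _ => ChangePoint.failProbSHA_le_exp hv hσ hη hη2 hB0 hB1 hL
      ((sq_nonneg _).trans hγ.1.le) hγ.2.le hb⟩
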